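/- Let $c\ge 0$ and $\kappa\in\mathbb{R}$ satisfy $(c,\kappa)\in\tilde{\mathcal D}\cup\mathcal C$, where $$\tilde{\mathcal D}=\{0\le c<\sqrt2,\ 0<\kappa<\tfrac12\}\cup\{c>\sqrt2,\ \kappa>\tfrac12\}\cup\{c=\sqrt2,\ 0<\kappa<\tfrac12\}\cup\{c=\sqrt2,\ \kappa>\tfrac12\},\qquad \mathcal C=\{c\ge0,\ \kappa=\tfrac12\}.$$ Let $$\mathcal X(\mathbb R)=\{v\in H^1_{\mathrm{loc}}(\mathbb R;\mathbb C):\ 1-|v|^2\in L^2(\mathbb R),\ v'\in L^2(\mathbb R)\},\qquad \mathcal{NX}(\mathbb R)=\{v\in\mathcal X(\mathbb R):\ \inf_{\mathbb R}|v|>0\},$$ where every element of $\mathcal X(\mathbb R)$ is identified with its continuous representative (which exists). Let $u\in\mathcal X(\mathbb R)$ be a weak solution of $$icu'+u''+u(1-|u|^2)+\kappa u(1-|u|^2)''=0\quad\text{in }\mathbb R,$$ that is, with $\langle z_1,z_2\rangle=\operatorname{Re}(z_1\bar z_2)$, for all $\phi\in\mathcal C_0^\infty(\mathbb R;\mathbb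 C)$, $$\int_{\mathbb R}\langle icu'+u(1-|u|^2),\phi\rangle-\langle u',\phi'\rangle+2\kappa\langle u,u'\rangle\langle u,\phi\rangle'=0 .$$ If $c>0$, then $u\in\mathcal{NX}(\mathbb R)$. If $c=0$, then there exists $\phi\in\mathbb R$ such that $e^{i\phi}u(x)\in\mathbb R$ for all $x\in\mathbb R$. -/

import Mathlib

open MeasureTheory

open scoped ContDiff

noncomputable section

namespace QGP

/-- The parameter region `0 ≤ c < √2`, `0 < κ < 1/2`. -/
def regionD1 : Set (ℝ × ℝ) :=
  {p | 0 ≤ p.1 ∧ p.1 < Real.sqrt 2 ∧ 0 < p.2 ∧ p.2 < 1 / 2}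

/-- The parameter region `c > √2`, `κ > 1/2`. -/
def regionD3 : Set (ℝ × ℝ) :=
  {p | Real.sqrt 2 < p.1 ∧ 1 / 2 < p.2}

/-- The sonic boundary `c = √2`, `0 < κ < 1/2`. -/
def boundaryBminus : Set (ℝ × ℝ) :=
  {p | p.1 = Real.sqrt 2 ∧ 0 < p.2 ∧ p.2 < 1 / 2}

/-- The sonic boundary `c = √2`, `κ > 1/2`. -/
def boundaryBplus : Set (ℝ × ℝ) :=
  {p | p.1 = Real.sqrt 2 ∧ 1 / 2 < p.2}

/-- The critical set `c ≥ 0`, `κ = 1/2`. -/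
def criticalC : Set (ℝ × ℝ) :=
  {p | 0 ≤ p.1 ∧ p.2 = 1 / 2}

/-- The set `𝒟̃ = 𝒟₁ ∪ 𝒟₃ ∪ ℬ₋ ∪ ℬ₊`. -/
def regionDtilde : Set (ℝ × ℝ) :=
  regionD1 ∪ regionD3 ∪ boundaryBminus ∪ boundaryBplus

/-- `f ∈ L²_loc(ℝ; ℂ)`. -/
def MemL2Loc (f : ℝ → ℂ) : Prop :=
  ∀ K : Set ℝ, IsCompact K → MemLp f 2 (volume.restrict K)

/-- `v` is a weak (distributional) derivative of `u` on `ℝ`. -/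
def HasWeakDeriv (u v : ℝ → ℂ) : Prop :=
  LocallyIntegrable u volume ∧ LocallyIntegrable v volume ∧
    ∀ φ : ℝ → ℝ, ContDiff ℝ ∞ φ → HasCompactSupport φ →
      ∫ x, deriv φ x • u x = - ∫ x, φ x • v x

/-- `u ∈ H¹_loc(ℝ; ℂ)`. -/
def MemH1Loc (u : ℝ → ℂ) : Prop :=
  MemL2Loc u ∧ ∃ v : ℝ → ℂ, MemL2Loc v ∧ HasWeakDeriv u v

/-- The energy space: `u ∈ H¹_loc(ℝ)`, `1 - |u|² ∈ L²(ℝ)` and `u' ∈ L²(ℝ)`. -/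
def MemX (u : ℝ → ℂ) : Prop :=
  MemH1Loc u ∧ MemLp (fun x => 1 - ‖u x‖ ^ 2) 2 volume ∧
    ∃ v : ℝ → ℂ, HasWeakDeriv u v ∧ MemLp v 2 volume

/-- The nonvanishing energy space: `u` lies in the energy space and `inf_ℝ |u| > 0`.
The infimum is pointwise, so `u` is meant to be the continuous representative of its class. -/
def MemNX (u : ℝ → ℂ) : Prop :=
  MemX u ∧ 0 < ⨅ x : ℝ, ‖u x‖

/-- `u` is a weak solution of `i c u' + u'' + u (1 - |u|²) + κ u (1 - |u|²)'' = 0`; here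
`v = u'` is the weak derivative (unique almost everywhere), `inner ℝ` is the real scalar product
`Re (z₁ * conj z₂)` of `ℂ`, and `⟨v, φ⟩ + ⟨u, φ'⟩` is the derivative of `⟨u, φ⟩`. All the
integrands are integrable for `u ∈ H¹_loc(ℝ)`. -/
def IsWeakSolution (c κ : ℝ) (u : ℝ → ℂ) : Prop :=
  MemH1Loc u ∧ ∃ v : ℝ → ℂ, MemL2Loc v ∧ HasWeakDeriv u v ∧
    ∀ φ : ℝ → ℂ, ContDiff ℝ ∞ φ → HasCompactSupport φ →
      ∫ x, (inner ℝ (Complex.I * c * v x + u x * ((1 - ‖u x‖ ^ 2 : ℝ) : ℂ)) (φ x)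
        - inner ℝ (v x) (deriv φ x)
        + 2 * κ * inner ℝ (u x) (v x)
          * (inner ℝ (v x) (φ x) + inner ℝ (u x) (deriv φ x))) = 0

end QGP

end

/-! The equation says that the flux `p = w' - 2κ⟨w, w'⟩w` has a locally integrable derivative, so
`w` and `p` are both continuous. Pairing the equation with `iw` shows that the momentum `⟨iw, p⟩ +
(c/2)|w|²` is constant. Since `⟨iw, p⟩ = ⟨iw, w'⟩` and `1 - |w|²` are square integrable, the
constant is `c/2`, that is, `⟨iw, p⟩ = (c/2)(1 - |w|²)`. For `c ≠ 0` this fails at a zero of `w`,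
and `|w| → 1` at infinity. For `c = 0` it says that at a point `x₀` with `w x₀ ≠ 0` both `⟨i w x₀,
w⟩` and `⟨i w x₀, p⟩` vanish; these two functions solve a linear system with locally integrable
coefficients, hence vanish identically. -/

open Filter Set Topology
open scoped ENNReal InnerProductSpace

section Primitive

theorem intervalIntegrable_of_locallyIntegrable {E : Type*} [NormedAddCommGroup E]
    {f : ℝ → E} (hf : LocallyIntegrable f volume) (a b : ℝ) :
    IntervalIntegrable f volume a b :=
  (hf.integrableOn_isCompact isCompact_uIcc).intervalIntegrable

variable {E F : Type*} [NormedAddCommGroup E] [NormedSpace ℝ E]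
  [NormedAddCommGroup F] [NormedSpace ℝ F]

/-- `f` is a primitive of the locally integrable function `f'`, in the sense of the Lebesgue
integral; this is the pointwise counterpart of `QGP.HasWeakDeriv`. Stating it through integrals
rather than as local absolute continuity makes it available for every normed space `E`. -/
structure IsPrimitive (f f' : ℝ → E) : Prop where
  locallyIntegrable : LocallyIntegrable f' volume
  integral_eq_sub : ∀ a b, ∫ x in a..b, f' x = f b - f a

theorem locallyIntegrable_clm_comp {X : Type*} [TopologicalSpace X] [MeasurableSpace X]
    {μ : Measure X} {f : X → E} (L : E →L[ℝ] F) (hf : LocallyIntegrable f μ) :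
    LocallyIntegrable (fun x => L (f x)) μ := fun x =>
  let ⟨s, hs, hfs⟩ := hf x
  ⟨s, hs, L.integrable_comp hfs⟩

theorem isPrimitive_integral {f : ℝ → E} (hf : LocallyIntegrable f volume) (a : ℝ) :
    IsPrimitive (fun x => ∫ t in a..x, f t) f where
  locallyIntegrable := hf
  integral_eq_sub _ _ := by
    rw [intervalIntegral.integral_interval_sub_left] <;>
      exact intervalIntegrable_of_locallyIntegrable hf _ _

theorem isPrimitive_deriv [CompleteSpace E] {f : ℝ → E} (hf : ContDiff ℝ 1 f) :
    IsPrimitive f (deriv f) where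
  locallyIntegrable := (hf.continuous_deriv le_rfl).locallyIntegrable
  integral_eq_sub a b := intervalIntegral.integral_deriv_eq_sub
    (fun x _ => hf.differentiable one_ne_zero x)
    ((hf.continuous_deriv le_rfl).intervalIntegrable a b)

namespace IsPrimitive

variable {f f' g g' : ℝ → E}

theorem intervalIntegrable (hf : IsPrimitive f f') (a b : ℝ) :
    IntervalIntegrable f' volume a b :=
  intervalIntegrable_of_locallyIntegrable hf.locallyIntegrable a b

theorem eq_add_integral (hf : IsPrimitive f f') (a : ℝ) :
    f = fun x => f a + ∫ t in a..x, f' t :=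
  funext fun x => by rw [hf.integral_eq_sub, add_sub_cancel]

theorem continuous (hf : IsPrimitive f f') : Continuous f := by
  rw [hf.eq_add_integral 0]
  exact continuous_const.add (intervalIntegral.continuous_primitive hf.intervalIntegrable 0)

theorem ae_hasDerivAt [CompleteSpace E] (hf : IsPrimitive f f') :
    ∀ᵐ x, HasDerivAt f (f' x) x := by
  filter_upwards [LocallyIntegrable.ae_hasDerivAt_integral hf.locallyIntegrable] with x hx
  rw [hf.eq_add_integral 0]
  exact (hx 0).const_add _

theorem congr_ae (hf : IsPrimitive f f') (h : f' =ᵐ[volume] g') : IsPrimitive f g' where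
  locallyIntegrable := hf.locallyIntegrable.congr h
  integral_eq_sub a b := by
    rw [← hf.integral_eq_sub a b]
    exact intervalIntegral.integral_congr_ae (h.mono fun x hx _ => hx.symm)

theorem eq_of_ae_eq_zero (hf : IsPrimitive f f') (h : f' =ᵐ[volume] 0) (x y : ℝ) : f x = f y := by
  have hxy := (hf.congr_ae h).integral_eq_sub y x
  simpa only [Pi.zero_apply, intervalIntegral.integral_zero, eq_comm, sub_eq_zero] using hxy

theorem add (hf : IsPrimitive f f') (hg : IsPrimitive g g') : IsPrimitive (f + g) (f' + g') where
  locallyIntegrable := hf.locallyIntegrable.add hg.locallyIntegrable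
  integral_eq_sub a b := by
    simp only [Pi.add_apply]
    rw [intervalIntegral.integral_add (hf.intervalIntegrable a b) (hg.intervalIntegrable a b),
      hf.integral_eq_sub, hg.integral_eq_sub]
    abel

theorem sum {ι : Type*} (s : Finset ι) {f f' : ι → ℝ → E} (hf : ∀ i ∈ s, IsPrimitive (f i) (f' i)) :
    IsPrimitive (∑ i ∈ s, f i) (∑ i ∈ s, f' i) := by
  classical
  induction s using Finset.induction_on with
  | empty => exact ⟨locallyIntegrable_zero, fun a b => by simp⟩
  | insert i s hi ih =>
    rw [Finset.sum_insert hi, Finset.sum_insert hi]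
    exact (hf i (s.mem_insert_self i)).add (ih fun j hj => hf j (Finset.mem_insert_of_mem hj))

theorem clm_comp [CompleteSpace E] [CompleteSpace F] (hf : IsPrimitive f f') (L : E →L[ℝ] F) :
    IsPrimitive (fun x => L (f x)) (fun x => L (f' x)) where
  locallyIntegrable := locallyIntegrable_clm_comp L hf.locallyIntegrable
  integral_eq_sub a b := by
    rw [L.intervalIntegral_comp_comm (hf.intervalIntegrable a b), hf.integral_eq_sub, map_sub]

theorem prodMk [CompleteSpace E] [CompleteSpace F] {g g' : ℝ → F} (hf : IsPrimitive f f')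
    (hg : IsPrimitive g g') : IsPrimitive (fun x => (f x, g x)) (fun x => (f' x, g' x)) := by
  simpa [Pi.add_def] using (hf.clm_comp (.inl ℝ E F)).add (hg.clm_comp (.inr ℝ E F))

theorem absolutelyContinuousOnInterval {f f' : ℝ → ℝ} (hf : IsPrimitive f f') (a b : ℝ) :
    AbsolutelyContinuousOnInterval f a b := by
  rw [hf.eq_add_integral a]
  exact contDiff_const.contDiffOn.absolutelyContinuousOnInterval.fun_add
    ((hf.intervalIntegrable a b).absolutelyContinuousOnInterval_intervalIntegral left_mem_uIcc)

theorem mul {f f' g g' : ℝ → ℝ} (hf : IsPrimitive f f') (hg : IsPrimitive g g') :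
    IsPrimitive (f * g) (f' * g + f * g') where
  locallyIntegrable := by
    refine .add ?_ ?_
    · simpa only [mul_comm f', smul_eq_mul, Pi.smul_def, Pi.mul_def] using
        hf.locallyIntegrable.continuous_smul hg.continuous
    · exact hg.locallyIntegrable.continuous_smul hf.continuous
  integral_eq_sub a b := by
    simp only [Pi.mul_apply]
    rw [← (hf.absolutelyContinuousOnInterval a b).integral_deriv_mul_eq_sub
      (hg.absolutelyContinuousOnInterval a b)]
    refine intervalIntegral.integral_congr_ae ?_
    filter_upwards [hf.ae_hasDerivAt, hg.ae_hasDerivAt] with x hfx hgx _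
    rw [hfx.deriv, hgx.deriv, Pi.add_apply, Pi.mul_apply, Pi.mul_apply]

theorem smul [CompleteSpace E] {φ φ' : ℝ → ℝ} (hφ : IsPrimitive φ φ') (hf : IsPrimitive f f') :
    IsPrimitive (φ • f) (φ' • f + φ • f') := by
  have hint : LocallyIntegrable (φ' • f + φ • f') volume :=
    (hφ.locallyIntegrable.smul_continuous hf.continuous).add
      (hf.locallyIntegrable.continuous_smul hφ.continuous)
  refine ⟨hint, fun a b => (SeparatingDual.eq_iff_forall_dual_eq (R := ℝ)).2 fun L => ?_⟩
  rw [← L.intervalIntegral_comp_comm (intervalIntegrable_of_locallyIntegrable hint a b)]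
  simpa using (hφ.mul (hf.clm_comp L)).integral_eq_sub a b

theorem inner {E : Type*} [NormedAddCommGroup E] [InnerProductSpace ℝ E] [FiniteDimensional ℝ E]
    {f f' g g' : ℝ → E} (hf : IsPrimitive f f') (hg : IsPrimitive g g') :
    IsPrimitive (fun x => ⟪f x, g x⟫_ℝ) (fun x => ⟪f' x, g x⟫_ℝ + ⟪f x, g' x⟫_ℝ) := by
  have := FiniteDimensional.complete ℝ E
  let b := stdOrthonormalBasis ℝ E
  convert! sum Finset.univ fun i _ =>
    (hf.clm_comp (innerSL ℝ (b i))).mul (hg.clm_comp (innerSL ℝ (b i))) using 1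
  · ext x
    simp [← b.sum_inner_mul_inner (f x) (g x), real_inner_comm]
  · ext x
    simp [← b.sum_inner_mul_inner (f' x) (g x), ← b.sum_inner_mul_inner (f x) (g' x),
      real_inner_comm, Finset.sum_add_distrib]

theorem integral_eq_zero [CompleteSpace E] (hf : IsPrimitive f f')
    (h0 : Tendsto f (cocompact ℝ) (𝓝 0)) (hi : Integrable f' volume) : ∫ x, f' x = 0 := by
  rw [cocompact_eq_atBot_atTop, tendsto_sup] at h0
  refine tendsto_nhds_unique
    (intervalIntegral_tendsto_integral hi tendsto_neg_atTop_atBot tendsto_id) ?_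
  simpa only [hf.integral_eq_sub, sub_zero, Function.comp_def, id] using
    h0.2.sub (h0.1.comp tendsto_neg_atTop_atBot)

theorem integral_deriv_smul_eq_neg [CompleteSpace E] (hf : IsPrimitive f f') {φ : ℝ → ℝ}
    (hφ : ContDiff ℝ 1 φ) (hφc : HasCompactSupport φ) :
    ∫ x, deriv φ x • f x = -∫ x, φ x • f' x := by
  have hl : Integrable (fun x => deriv φ x • f x) volume :=
    ((hφ.continuous_deriv le_rfl).smul hf.continuous).integrable_of_hasCompactSupport
      hφc.deriv.smul_right
  have hr : Integrable (fun x => φ x • f' x) volume :=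
    hf.locallyIntegrable.integrable_smul_left_of_hasCompactSupport hφ.continuous hφc
  rw [eq_neg_iff_add_eq_zero, ← integral_add hl hr]
  exact ((isPrimitive_deriv hφ).smul hf).integral_eq_zero
    (hφc.smul_right.is_zero_at_infty) (hl.add hr)

theorem eventually_eq_zero_of_norm_le (hf : IsPrimitive f f') {a : ℝ → ℝ}
    (ha : LocallyIntegrable a volume) (hle : ∀ᵐ x, ‖f' x‖ ≤ a x * ‖f x‖) {x₀ : ℝ}
    (h0 : f x₀ = 0) : ∀ᶠ x in 𝓝 x₀, f x = 0 := by
  -- On a ball where `|∫ ‖a‖| < 1`, the maximum of `‖f‖` is at most a smaller multiple of itself.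
  have hsmall : ∀ᶠ x in 𝓝 x₀, |∫ t in x₀..x, ‖a t‖| < 1 := by
    have hc := (intervalIntegral.continuous_primitive
      (fun a b => (intervalIntegrable_of_locallyIntegrable ha a b).norm) x₀).abs.tendsto x₀
    rw [intervalIntegral.integral_same, abs_zero] at hc
    exact hc.eventually_lt_const one_pos
  obtain ⟨r, hr, hball⟩ := Metric.nhds_basis_closedBall.eventually_iff.1 hsmall
  obtain ⟨M, hM, hmax⟩ := (isCompact_closedBall x₀ r).exists_isMaxOn
    ⟨x₀, Metric.mem_closedBall_self hr.le⟩ hf.continuous.norm.continuousOn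
  have hsub : uIoc x₀ M ⊆ Metric.closedBall x₀ r :=
    uIoc_subset_uIcc.trans <| (convex_closedBall x₀ r).ordConnected.uIcc_subset
      (Metric.mem_closedBall_self hr.le) hM
  have hbound : ‖f M‖ ≤ |∫ t in x₀..M, ‖a t‖| * ‖f M‖ := by
    calc ‖f M‖ = ‖∫ t in x₀..M, f' t‖ := by rw [hf.integral_eq_sub, h0, sub_zero]
      _ ≤ |∫ t in x₀..M, ‖a t‖ * ‖f M‖| := by
        refine intervalIntegral.norm_integral_le_abs_of_norm_le ?_
          ((intervalIntegrable_of_locallyIntegrable ha x₀ M).norm.mul_const _)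
        filter_upwards [ae_restrict_of_ae hle, ae_restrict_mem measurableSet_uIoc] with t ht htM
        exact ht.trans (mul_le_mul (le_abs_self _) (hmax (hsub htM)) (norm_nonneg _) (abs_nonneg _))
      _ = |∫ t in x₀..M, ‖a t‖| * ‖f M‖ := by
        rw [intervalIntegral.integral_mul_const, abs_mul, abs_norm]
  have hM0 : ‖f M‖ ≤ 0 := by nlinarith [hball hM]
  filter_upwards [Metric.closedBall_mem_nhds x₀ hr] with x hx
  exact norm_le_zero_iff.1 ((hmax hx).trans hM0)

theorem eq_zero_of_norm_le (hf : IsPrimitive f f') {a : ℝ → ℝ}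
    (ha : LocallyIntegrable a volume) (hle : ∀ᵐ x, ‖f' x‖ ≤ a x * ‖f x‖) {x₀ : ℝ}
    (h0 : f x₀ = 0) (x : ℝ) : f x = 0 := by
  have hopen : IsOpen {x | f x = 0} := isOpen_iff_mem_nhds.2 fun _ hz =>
    hf.eventually_eq_zero_of_norm_le ha hle hz
  have hclosed : IsClosed {x | f x = 0} := isClosed_eq hf.continuous continuous_const
  exact (IsClopen.eq_univ ⟨hclosed, hopen⟩ ⟨x₀, h0⟩).ge (mem_univ x)

theorem holderWith (hf : IsPrimitive f f') {p : ℝ≥0∞} (hp : 1 ≤ p) (h : MemLp f' p volume) :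
    HolderWith (eLpNorm f' p volume).toNNReal (1 - p.toReal⁻¹).toNNReal f := by
  intro x y
  have hexp : 0 ≤ 1 - p.toReal⁻¹ := by
    rcases eq_or_ne p ⊤ with rfl | htop
    · simp
    · exact sub_nonneg.2 (inv_le_one_of_one_le₀ (by simpa using ENNReal.toReal_mono htop hp))
  rw [ENNReal.coe_toNNReal h.eLpNorm_ne_top, Real.coe_toNNReal _ hexp]
  have hlen : volume (uIoc y x) = edist x y := by
    rw [Real.volume_uIoc, edist_dist, Real.dist_eq]
  calc edist (f x) (f y) = ‖∫ t in y..x, f' t‖ₑ := by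
        rw [hf.integral_eq_sub, edist_eq_enorm_sub]
    _ ≤ eLpNorm f' 1 (volume.restrict (uIoc y x)) := by
        rw [eLpNorm_one_eq_lintegral_enorm, ← ofReal_norm,
          intervalIntegral.norm_intervalIntegral_eq, ofReal_norm]
        exact enorm_integral_le_lintegral_enorm _
    _ ≤ eLpNorm f' p (volume.restrict (uIoc y x)) * edist x y ^ (1 - p.toReal⁻¹) := by
        simpa only [Measure.restrict_apply_univ, hlen, ENNReal.toReal_one, div_one, one_div] using
          eLpNorm_le_eLpNorm_mul_rpow_measure_univ hp (h.1.restrict (s := uIoc y x))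
    _ ≤ eLpNorm f' p volume * edist x y ^ (1 - p.toReal⁻¹) := by
        gcongr
        exact Measure.restrict_le_self

theorem uniformContinuous (hf : IsPrimitive f f') {p : ℝ≥0∞} (hp : 1 < p)
    (h : MemLp f' p volume) : UniformContinuous f := by
  refine (hf.holderWith hp.le h).uniformContinuous (Real.toNNReal_pos.2 (sub_pos.2 ?_))
  rcases eq_or_ne p ⊤ with rfl | htop
  · simp
  · exact inv_lt_one_of_one_lt₀ (by simpa using (ENNReal.toReal_lt_toReal (by simp) htop).2 hp)

end IsPrimitive

end Primitive

section DuBoisReymond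

variable {E : Type*} [NormedAddCommGroup E] [NormedSpace ℝ E] [CompleteSpace E]

theorem exists_contDiff_hasCompactSupport_deriv_eq {θ : ℝ → E} (hθ : ContDiff ℝ ∞ θ)
    (hθc : HasCompactSupport θ) (h0 : ∫ x, θ x = 0) :
    ∃ Φ : ℝ → E, ContDiff ℝ ∞ Φ ∧ HasCompactSupport Φ ∧ deriv Φ = θ := by
  obtain ⟨R, hR⟩ := hθc.isCompact.isBounded.subset_ball 0
  have hsupp : Function.support θ ⊆ Ioo (-R) R := by
    simpa [Real.ball_eq_Ioo] using (subset_tsupport θ).trans hR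
  have hderiv (x : ℝ) : HasDerivAt (fun x => ∫ t in -R..x, θ t) (θ x) x :=
    (hθ.continuous.integral_hasStrictDerivAt _ x).hasDerivAt
  have hderiv_eq : deriv (fun x => ∫ t in -R..x, θ t) = θ := funext fun x => (hderiv x).deriv
  refine ⟨fun x => ∫ t in -R..x, θ t,
    contDiff_infty_iff_deriv.2 ⟨fun x => (hderiv x).differentiableAt, by rwa [hderiv_eq]⟩,
    .intro (isCompact_Icc (a := -R) (b := R)) fun x hx => ?_, hderiv_eq⟩
  rcases lt_or_ge x (-R) with hlt | hge
  · refine intervalIntegral.integral_zero_ae (.of_forall fun t ht => ?_)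
    rw [uIoc_of_ge hlt.le] at ht
    exact Function.notMem_support.1 fun htR => ht.2.not_gt (hsupp htR).1
  · have hRx : R < x := lt_of_not_ge fun h => hx ⟨hge, h⟩
    rw [intervalIntegral.integral_eq_integral_of_support_subset
      fun t ht => ⟨(hsupp ht).1, (hsupp ht).2.le.trans hRx.le⟩, h0]

theorem ae_eq_const_of_integral_deriv_smul_eq_zero {f : ℝ → E} (hf : LocallyIntegrable f volume)
    (h : ∀ φ : ℝ → ℝ, ContDiff ℝ ∞ φ → HasCompactSupport φ → ∫ x, deriv φ x • f x = 0) :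
    ∃ C, f =ᵐ[volume] fun _ => C := by
  let ψ := (⟨1, 2, one_pos, one_lt_two⟩ : ContDiffBump (0 : ℝ)).normed volume
  have hψ : ContDiff ℝ ∞ ψ := ContDiffBump.contDiff_normed _
  have hψc : HasCompactSupport ψ := ContDiffBump.hasCompactSupport_normed _
  have hψ1 : ∫ x, ψ x = 1 := ContDiffBump.integral_normed _
  refine ⟨∫ x, ψ x • f x, ae_eq_of_integral_contDiff_smul_eq hf (locallyIntegrable_const _)
    fun φ hφ hφc => ?_⟩
  have hi : ∀ {θ : ℝ → ℝ}, ContDiff ℝ ∞ θ → HasCompactSupport θ →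
      Integrable (fun x => θ x • f x) volume := fun hθ hθc =>
    hf.integrable_smul_left_of_hasCompactSupport hθ.continuous hθc
  -- Subtracting a multiple of `ψ` makes the test function mean-free, hence a derivative.
  obtain ⟨Φ, hΦ, hΦc, hΦ'⟩ := exists_contDiff_hasCompactSupport_deriv_eq
    (θ := fun x => φ x - (∫ y, φ y) * ψ x) (hφ.sub (contDiff_const.mul hψ))
    (hφc.sub hψc.mul_left) (by
      rw [integral_sub (hφ.continuous.integrable_of_hasCompactSupport hφc)
        ((hψ.continuous.integrable_of_hasCompactSupport hψc).const_mul _), integral_const_mul,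
        hψ1, mul_one, sub_self])
  have hΦf := h Φ hΦ hΦc
  simp only [hΦ', sub_smul, mul_smul] at hΦf
  rw [integral_sub (hi hφ hφc) ((hi hψ hψc).fun_smul _), integral_smul, sub_eq_zero] at hΦf
  rw [hΦf, integral_smul_const]

theorem exists_isPrimitive_ae_eq {f g : ℝ → E} (hf : LocallyIntegrable f volume)
    (hg : LocallyIntegrable g volume)
    (h : ∀ φ : ℝ → ℝ, ContDiff ℝ ∞ φ → HasCompactSupport φ →
      ∫ x, deriv φ x • f x = -∫ x, φ x • g x) :
    ∃ w, IsPrimitive w g ∧ w =ᵐ[volume] f := by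
  have hG := isPrimitive_integral hg 0
  obtain ⟨C, hC⟩ := ae_eq_const_of_integral_deriv_smul_eq_zero
    (hf.sub hG.continuous.locallyIntegrable) fun φ hφ hφc => by
      have hi : ∀ {k : ℝ → E}, LocallyIntegrable k volume →
          Integrable (fun x => deriv φ x • k x) volume := fun hk =>
        hk.integrable_smul_left_of_hasCompactSupport
          (hφ.continuous_deriv (by simp)) hφc.deriv
      simp only [Pi.sub_apply, smul_sub]
      rw [integral_sub (hi hf) (hi hG.continuous.locallyIntegrable), h φ hφ hφc,
        hG.integral_deriv_smul_eq_neg (hφ.of_le (by simp)) hφc, sub_self]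
  refine ⟨fun x => C + ∫ t in 0..x, g t, ⟨hg, fun a b => ?_⟩, ?_⟩
  · rw [hG.integral_eq_sub, add_sub_add_left_eq_sub]
  · filter_upwards [hC] with x hx
    rw [← hx, Pi.sub_apply, sub_add_cancel]

end DuBoisReymond

section Infinity

theorem tendsto_cocompact_zero_of_uniformContinuous_of_memLp {E F : Type*} [NormedAddCommGroup E]
    [NormedSpace ℝ E] [FiniteDimensional ℝ E] [MeasurableSpace E] [BorelSpace E]
    [NormedAddCommGroup F] {μ : Measure E} [μ.IsAddHaarMeasure] {f : E → F} {p : ℝ≥0∞}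
    (hf : UniformContinuous f) (hp₀ : p ≠ 0) (hp : p ≠ ⊤) (hfp : MemLp f p μ) :
    Tendsto f (cocompact E) (𝓝 0) := by
  have := FiniteDimensional.proper_real E
  refine Metric.tendsto_nhds.2 fun ε hε => ?_
  obtain ⟨δ, hδ, hfδ⟩ := Metric.uniformContinuous_iff.1 hf (ε / 2) (half_pos hε)
  let S := {x | ε / 2 ≤ ‖f x‖}
  have hS : μ S < ⊤ := hfp.meas_ge_lt_top (ε := ⟨ε / 2, (half_pos hε).le⟩) hp₀ hp
    (NNReal.coe_ne_zero.1 (half_pos hε).ne')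
  have : IsFiniteMeasure (μ.restrict S) := isFiniteMeasure_restrict.2 hS.ne
  have hball : 0 < μ (Metric.ball 0 δ) := Metric.measure_ball_pos μ 0 hδ
  obtain ⟨K, hK, hKS⟩ := isTightMeasureSet_iff_exists_isCompact_measure_compl_le.1
    (isTightMeasureSet_singleton (μ := μ.restrict S)) _ (ENNReal.half_pos hball.ne')
  filter_upwards [(hK.cthickening (r := δ)).compl_mem_cocompact] with x hx
  by_contra! hfx
  have hxS : Metric.ball x δ ⊆ S := fun y hy => by
    have hxy := norm_sub_norm_le (f x) (f y)
    have := hfδ (Metric.mem_ball'.1 hy)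
    rw [dist_zero_right] at hfx
    rw [dist_eq_norm] at this
    change ε / 2 ≤ ‖f y‖
    linarith
  have hxK : Metric.ball x δ ⊆ Kᶜ := fun y hy hyK =>
    hx (Metric.mem_cthickening_of_dist_le x y δ K hyK (Metric.mem_ball'.1 hy).le)
  refine (ENNReal.half_lt_self hball.ne' measure_ball_lt_top.ne).not_ge ?_
  calc μ (Metric.ball 0 δ) = μ (Metric.ball x δ) := (Measure.addHaar_ball_center μ x δ).symm
    _ = μ.restrict S (Metric.ball x δ) := by
      rw [Measure.restrict_apply measurableSet_ball, inter_eq_left.2 hxS]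
    _ ≤ μ.restrict S Kᶜ := measure_mono hxK
    _ ≤ μ (Metric.ball 0 δ) / 2 := hKS _ rfl

theorem tendsto_cocompact_norm_one {E F : Type*} [NormedAddCommGroup E]
    [NormedSpace ℝ E] [FiniteDimensional ℝ E] [MeasurableSpace E] [BorelSpace E]
    [NormedAddCommGroup F] {μ : Measure E} [μ.IsAddHaarMeasure] {f : E → F} {p : ℝ≥0∞}
    (hf : UniformContinuous f) (hp₀ : p ≠ 0) (hp : p ≠ ⊤)
    (hfp : MemLp (fun x => 1 - ‖f x‖ ^ 2) p μ) :
    Tendsto (fun x => ‖f x‖) (cocompact E) (𝓝 1) := by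
  have hunif : UniformContinuous fun x => ‖f x‖ - 1 :=
    (uniformContinuous_norm.comp hf).sub uniformContinuous_const
  have hle (x : E) : ‖‖f x‖ - 1‖ ≤ ‖1 - ‖f x‖ ^ 2‖ := by
    rw [show 1 - ‖f x‖ ^ 2 = (1 - ‖f x‖) * (1 + ‖f x‖) by ring, norm_mul, norm_sub_rev]
    refine le_mul_of_one_le_right (norm_nonneg _) ((le_add_of_nonneg_right (norm_nonneg _)).trans
      (le_abs_self _))
  simpa only [sub_add_cancel, zero_add] using
    (tendsto_cocompact_zero_of_uniformContinuous_of_memLp hunif hp₀ hp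
      (hfp.mono hunif.continuous.aestronglyMeasurable (.of_forall hle))).add_const 1

variable {X : Type*} [TopologicalSpace X] {f : X → ℝ} {a : ℝ}

theorem bddAbove_range_of_tendsto_cocompact (hf : Continuous f)
    (hlim : Tendsto f (cocompact X) (𝓝 a)) : BddAbove (range f) := by
  obtain ⟨K, hK, hKf⟩ := mem_cocompact.1 (hlim.eventually_le_const (lt_add_one a))
  rw [← image_univ, ← union_compl_self K, image_union]
  exact (hK.bddAbove_image hf.continuousOn).union ⟨a + 1, forall_mem_image.2 fun _ hx => hKf hx⟩

theorem iInf_pos_of_tendsto_cocompact [Nonempty X] (hf : Continuous f)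
    (hlim : Tendsto f (cocompact X) (𝓝 a)) (ha : 0 < a) (hpos : ∀ x, 0 < f x) : 0 < ⨅ x, f x := by
  by_cases h : ∃ x₀, f x₀ < a
  · obtain ⟨x₀, hx₀⟩ := h
    obtain ⟨x, hx⟩ := hf.exists_forall_le' x₀ (hlim.eventually_const_le hx₀)
    exact (hpos x).trans_le (le_ciInf hx)
  · exact ha.trans_le (le_ciInf fun x => not_lt.1 fun hx => h ⟨x, hx⟩)

end Infinity

theorem locallyIntegrable_continuous_inner {E : Type*} [NormedAddCommGroup E]
    [InnerProductSpace ℝ E] {w v : ℝ → E} (hw : Continuous w) (hv : LocallyIntegrable v volume) :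
    LocallyIntegrable (fun x => ⟪w x, v x⟫_ℝ) volume :=
  (hv.continuous_smul hw.norm).mono (hw.aestronglyMeasurable.inner hv.aestronglyMeasurable)
    (.of_forall fun x => by
      simpa only [norm_smul, norm_norm] using norm_inner_le_norm (𝕜 := ℝ) (w x) (v x))

namespace QGP

variable {c κ : ℝ} {u v w p : ℝ → ℂ}

theorem HasWeakDeriv.exists_isPrimitive (h : HasWeakDeriv u v) :
    ∃ w, IsPrimitive w v ∧ w =ᵐ[volume] u :=
  exists_isPrimitive_ae_eq h.1 h.2.1 h.2.2

theorem hasWeakDeriv_of_isPrimitive (h : IsPrimitive w v) : HasWeakDeriv w v :=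
  ⟨h.continuous.locallyIntegrable, h.locallyIntegrable, fun _ hφ hφc =>
    h.integral_deriv_smul_eq_neg (hφ.of_le (by simp)) hφc⟩

theorem HasWeakDeriv.ae_eq {v' : ℝ → ℂ} (h : HasWeakDeriv u v) (h' : HasWeakDeriv u v') :
    v =ᵐ[volume] v' :=
  ae_eq_of_integral_contDiff_smul_eq h.2.1 h'.2.1 fun φ hφ hφc =>
    neg_injective ((h.2.2 φ hφ hφc).symm.trans (h'.2.2 φ hφ hφc))

theorem HasWeakDeriv.congr_left (h : HasWeakDeriv u v) (huw : u =ᵐ[volume] w) :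
    HasWeakDeriv w v := by
  refine ⟨h.1.congr huw, h.2.1, fun φ hφ hφc => ?_⟩
  rw [← h.2.2 φ hφ hφc]
  exact integral_congr_ae (huw.mono fun x hx => by simp only [hx])

theorem MemX.congr (h : MemX u) (huw : u =ᵐ[volume] w) : MemX w := by
  obtain ⟨⟨hu, v, hv, huv⟩, hη, v', huv', hv'⟩ := h
  exact ⟨⟨fun K hK => (memLp_congr_ae (ae_restrict_of_ae huw)).1 (hu K hK), v, hv,
    huv.congr_left huw⟩, (memLp_congr_ae (huw.mono fun x hx => by simp only [hx])).1 hη,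
    v', huv'.congr_left huw, hv'⟩

section FiniteEnergy

variable (hw : MemX w) (h : IsPrimitive w v)
include hw h

theorem MemX.memLp_deriv : MemLp v 2 volume := by
  obtain ⟨-, -, v', hv', hv'2⟩ := hw
  exact (memLp_congr_ae (hv'.ae_eq (hasWeakDeriv_of_isPrimitive h))).1 hv'2

theorem MemX.tendsto_norm : Tendsto (fun x => ‖w x‖) (cocompact ℝ) (𝓝 1) :=
  tendsto_cocompact_norm_one (h.uniformContinuous ENNReal.one_lt_two (hw.memLp_deriv h)) two_ne_zero
    ENNReal.ofNat_ne_top hw.2.1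

theorem MemX.bddAbove_range_norm : BddAbove (range fun x => ‖w x‖) :=
  bddAbove_range_of_tendsto_cocompact h.continuous.norm (hw.tendsto_norm h)

end FiniteEnergy

/-- The value `u' - 2κ⟨u, u'⟩u` of the flux of the equation where `u = z` and `u' = ζ`; here
`-2⟨u, u'⟩` is the derivative of `1 - |u|²`. -/
noncomputable def flux (κ : ℝ) (z ζ : ℂ) : ℂ :=
  ζ - (2 * κ * ⟪z, ζ⟫_ℝ) • z

/-- The value `icu' + u(1 - |u|²) + 2κ⟨u, u'⟩u'` of the source where `u = z` and `u' = ζ`; the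
equation reads `(flux)' + source = 0`. -/
noncomputable def source (c κ : ℝ) (z ζ : ℂ) : ℂ :=
  c • (Complex.I * ζ) + (1 - ‖z‖ ^ 2) • z + (2 * κ * ⟪z, ζ⟫_ℝ) • ζ

/-- First-order form of the equation: `w` is a solution with derivative `v`, and `p` is the
continuous representative of its flux. -/
structure IsTravelingWave (c κ : ℝ) (w v p : ℝ → ℂ) : Prop where
  isPrimitive : IsPrimitive w v
  memL2Loc : MemL2Loc v
  isPrimitive_flux : IsPrimitive p fun x => -source c κ (w x) (v x)
  ae_eq_flux : p =ᵐ[volume] fun x => flux κ (w x) (v x)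

section LocallyIntegrable

theorem MemL2Loc.locallyIntegrable_sq_norm (hv : MemL2Loc v) :
    LocallyIntegrable (fun x => ‖v x‖ ^ 2) volume :=
  locallyIntegrable_iff.2 fun K hK =>
    (memLp_two_iff_integrable_sq_norm (hv K hK).aestronglyMeasurable).1 (hv K hK)

variable (hw : Continuous w) (hv : LocallyIntegrable v volume) (hv₂ : MemL2Loc v)

include hw hv hv₂ in
theorem locallyIntegrable_sq_inner : LocallyIntegrable (fun x => ⟪w x, v x⟫_ℝ ^ 2) volume :=
  (hv₂.locallyIntegrable_sq_norm.continuous_smul (hw.norm.pow 2)).mono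
    ((hw.aestronglyMeasurable.inner hv.aestronglyMeasurable).pow 2) (.of_forall fun x => by
      rw [smul_eq_mul, Pi.pow_apply, ← mul_pow, norm_pow, norm_pow, norm_mul, norm_norm, norm_norm]
      gcongr
      exact norm_inner_le_norm _ _)

include hw hv in
theorem locallyIntegrable_flux (κ : ℝ) :
    LocallyIntegrable (fun x => flux κ (w x) (v x)) volume :=
  hv.sub (((locallyIntegrable_continuous_inner hw hv).smul (2 * κ)).smul_continuous hw)

include hw hv hv₂ in
theorem locallyIntegrable_source (c κ : ℝ) :
    LocallyIntegrable (fun x => source c κ (w x) (v x)) volume := by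
  refine .add (.add ?_ ?_) ?_
  · exact (locallyIntegrable_clm_comp (.mul ℝ ℂ Complex.I) hv).smul c
  · exact Continuous.locallyIntegrable (by fun_prop)
  · have hdom : LocallyIntegrable (fun x => ⟪w x, v x⟫_ℝ ^ 2 + ‖v x‖ ^ 2) volume :=
      (locallyIntegrable_sq_inner hw hv hv₂).add hv₂.locallyIntegrable_sq_norm
    have hinner : LocallyIntegrable (fun x => ⟪w x, v x⟫_ℝ • v x) volume := by
      refine hdom.mono ((hw.aestronglyMeasurable.inner hv.aestronglyMeasurable).fun_smul
        hv.aestronglyMeasurable) (.of_forall fun x => ?_)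
      rw [norm_smul, Real.norm_eq_abs, Real.norm_of_nonneg (by positivity), ← sq_abs ⟪w x, v x⟫_ℝ]
      nlinarith [two_mul_le_add_sq |⟪w x, v x⟫_ℝ| ‖v x‖, abs_nonneg ⟪w x, v x⟫_ℝ, norm_nonneg (v x)]
    simpa only [smul_smul, Pi.smul_def] using hinner.smul (2 * κ)

end LocallyIntegrable

theorem inner_smul_source_sub_smul_flux (c κ a b : ℝ) (z ζ e : ℂ) :
    ⟪e, a • source c κ z ζ - b • flux κ z ζ⟫_ℝ =
      ⟪Complex.I * c * ζ + z * ((1 - ‖z‖ ^ 2 : ℝ) : ℂ), a • e⟫_ℝ - ⟪ζ, b • e⟫_ℝ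
        + 2 * κ * ⟪z, ζ⟫_ℝ * (⟪ζ, a • e⟫_ℝ + ⟪z, b • e⟫_ℝ) := by
  simp only [source, flux, Complex.inner, Complex.sq_norm, Complex.normSq_apply, Complex.mul_re,
    Complex.mul_im, Complex.add_re, Complex.add_im, Complex.sub_re, Complex.sub_im,
    Complex.smul_re, Complex.smul_im, Complex.conj_re, Complex.conj_im, Complex.I_re,
    Complex.I_im, Complex.ofReal_re, Complex.ofReal_im, smul_eq_mul]
  ring

theorem IsWeakSolution.exists_isTravelingWave (h : IsWeakSolution c κ u) :
    ∃ w v p, w =ᵐ[volume] u ∧ IsTravelingWave c κ w v p := by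
  obtain ⟨-, v, hv₂, huv, hweak⟩ := h
  obtain ⟨w, hwv, hwu⟩ := huv.exists_isPrimitive
  have hflux := locallyIntegrable_flux hwv.continuous huv.2.1 κ
  have hsource := locallyIntegrable_source hwv.continuous huv.2.1 hv₂ c κ
  obtain ⟨p, hp, hpf⟩ := exists_isPrimitive_ae_eq hflux hsource.neg fun ψ hψ hψc => by
    have hl : Integrable (fun x => deriv ψ x • flux κ (w x) (v x)) volume :=
      hflux.integrable_smul_left_of_hasCompactSupport (hψ.continuous_deriv (by simp)) hψc.deriv
    have hr : Integrable (fun x => ψ x • source c κ (w x) (v x)) volume :=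
      hsource.integrable_smul_left_of_hasCompactSupport hψ.continuous hψc
    have hsub : Integrable (fun x => ψ x • source c κ (w x) (v x) -
        deriv ψ x • flux κ (w x) (v x)) volume := hr.sub hl
    simp only [Pi.neg_apply, smul_neg, integral_neg, neg_neg]
    rw [eq_comm, ← sub_eq_zero, ← integral_sub hr hl]
    refine ext_inner_left ℝ fun e => ?_
    rw [inner_zero_right, ← integral_inner hsub e,
      ← hweak (fun x => ψ x • e) (hψ.smul contDiff_const) hψc.smul_right]
    refine integral_congr_ae (hwu.mono fun x hx => ?_)
    simp only [deriv_smul_const (hψ.differentiable (by simp) x) e, ← hx]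
    exact inner_smul_source_sub_smul_flux c κ _ _ _ _ e
  exact ⟨w, v, p, hwu, hwv, hv₂, hp, hpf⟩

theorem norm_map_prodMk_source_le (κ : ℝ) (L : ℂ →L[ℝ] ℝ) (z ζ : ℂ) :
    ‖(L ζ, L (source 0 κ z ζ))‖ ≤
      (|1 - ‖z‖ ^ 2| + (2 + 2 * (2 * κ) ^ 2 * ⟪z, ζ⟫_ℝ ^ 2)) * ‖(L z, L (flux κ z ζ))‖ := by
  set σ := 2 * κ * ⟪z, ζ⟫_ℝ with hσ
  set N := ‖(L z, L (flux κ z ζ))‖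
  have hz : |L z| ≤ N := norm_fst_le (L z, L (flux κ z ζ))
  have hflux : |L (flux κ z ζ)| ≤ N := norm_snd_le (L z, L (flux κ z ζ))
  have hζ : |L ζ| ≤ (1 + |σ|) * N := by
    have heq : L ζ = L (flux κ z ζ) + σ * L z := by
      rw [flux, map_sub, map_smul, smul_eq_mul, sub_add_cancel]
    calc |L ζ| ≤ |L (flux κ z ζ)| + |σ| * |L z| := by
          rw [heq, ← abs_mul]; exact abs_add_le _ _
      _ ≤ (1 + |σ|) * N := by rw [add_mul, one_mul]; gcongr
  have hsource : |L (source 0 κ z ζ)| ≤ (|1 - ‖z‖ ^ 2| + |σ| * (1 + |σ|)) * N := by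
    have heq : L (source 0 κ z ζ) = (1 - ‖z‖ ^ 2) * L z + σ * L ζ := by
      rw [source, zero_smul, zero_add, map_add, map_smul, map_smul, smul_eq_mul, smul_eq_mul]
    calc |L (source 0 κ z ζ)| ≤ |1 - ‖z‖ ^ 2| * |L z| + |σ| * |L ζ| := by
          rw [heq, ← abs_mul, ← abs_mul]; exact abs_add_le _ _
      _ ≤ (|1 - ‖z‖ ^ 2| + |σ| * (1 + |σ|)) * N := by rw [add_mul, mul_assoc]; gcongr
  have hσ_sq : 2 * (2 * κ) ^ 2 * ⟪z, ζ⟫_ℝ ^ 2 = 2 * |σ| ^ 2 := by rw [sq_abs, hσ]; ring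
  rw [Prod.norm_mk, hσ_sq]
  refine max_le (hζ.trans (mul_le_mul_of_nonneg_right ?_ (norm_nonneg _)))
    (hsource.trans (mul_le_mul_of_nonneg_right ?_ (norm_nonneg _))) <;>
    nlinarith [sq_nonneg (|σ| - 1), abs_nonneg (1 - ‖z‖ ^ 2)]

theorem exp_neg_arg_mul_im_eq_zero {z₀ z : ℂ} (hz₀ : z₀ ≠ 0) (h : ⟪Complex.I * z₀, z⟫_ℝ = 0) :
    (Complex.exp (Complex.I * (-z₀.arg : ℝ)) * z).im = 0 := by
  refine mul_left_cancel₀ (norm_ne_zero_iff.2 hz₀) ?_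
  calc ‖z₀‖ * (Complex.exp (Complex.I * (-z₀.arg : ℝ)) * z).im
      = ‖z₀‖ * Real.cos z₀.arg * z.im - ‖z₀‖ * Real.sin z₀.arg * z.re := by
        rw [mul_comm Complex.I, Complex.mul_im, Complex.exp_ofReal_mul_I_re,
          Complex.exp_ofReal_mul_I_im, Real.cos_neg, Real.sin_neg]
        ring
    _ = ⟪Complex.I * z₀, z⟫_ℝ := by
        rw [Complex.norm_mul_cos_arg, Complex.norm_mul_sin_arg]
        simp only [Complex.inner, Complex.mul_re, Complex.mul_im, Complex.conj_re, Complex.conj_im,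
          Complex.I_re, Complex.I_im]
        ring
    _ = ‖z₀‖ * 0 := by rw [h, mul_zero]

namespace IsTravelingWave

theorem momentum_const (h : IsTravelingWave c κ w v p) (x y : ℝ) :
    ⟪Complex.I * w x, p x⟫_ℝ + c / 2 * ‖w x‖ ^ 2 =
      ⟪Complex.I * w y, p y⟫_ℝ + c / 2 * ‖w y‖ ^ 2 := by
  have hJ := ((h.isPrimitive.clm_comp (.mul ℝ ℂ Complex.I)).inner h.isPrimitive_flux).add
    ((h.isPrimitive.inner h.isPrimitive).clm_comp (.mul ℝ ℝ (c / 2)))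
  simpa [real_inner_self_eq_norm_sq] using hJ.eq_of_ae_eq_zero (by
    filter_upwards [h.ae_eq_flux] with t ht
    simp only [ht, flux, source, Complex.inner, Complex.sub_re, Complex.sub_im, Complex.add_re,
      Complex.add_im, Complex.smul_re, Complex.smul_im, Complex.neg_re, Complex.neg_im,
      Complex.mul_re, Complex.mul_im, Complex.conj_re, Complex.conj_im, Complex.I_re, Complex.I_im,
      ContinuousLinearMap.mul_apply', smul_eq_mul, Pi.zero_apply, Pi.add_apply]
    ring) x y

theorem momentum_eq (h : IsTravelingWave c κ w v p) (hw : MemX w) (x : ℝ) :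
    ⟪Complex.I * w x, p x⟫_ℝ = c / 2 * (1 - ‖w x‖ ^ 2) := by
  obtain ⟨M, hM⟩ := hw.bddAbove_range_norm h.isPrimitive
  have hv := hw.memLp_deriv h.isPrimitive
  have hwv : MemLp (fun t => ⟪Complex.I * w t, v t⟫_ℝ) 2 volume := by
    have hcont : Continuous fun t => Complex.I * w t := h.isPrimitive.continuous.const_mul _
    refine hv.of_le_mul (c := M) (hcont.aestronglyMeasurable.inner hv.1) (.of_forall fun t => ?_)
    refine (norm_inner_le_norm _ _).trans ?_
    gcongr
    simpa using hM (mem_range_self t)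
  have hconst : MemLp (fun _ : ℝ => ⟪Complex.I * w x, p x⟫_ℝ - c / 2 * (1 - ‖w x‖ ^ 2))
      2 volume := by
    refine (memLp_congr_ae ?_).1 (hwv.sub (hw.2.1.const_mul (c / 2)))
    filter_upwards [h.ae_eq_flux] with t ht
    have hpt : ⟪Complex.I * w t, p t⟫_ℝ = ⟪Complex.I * w t, v t⟫_ℝ := by
      have horth : ⟪Complex.I * w t, w t⟫_ℝ = 0 := by
        simp [Complex.inner, mul_comm]
      rw [ht, flux, inner_sub_right, real_inner_smul_right, horth, mul_zero, sub_zero]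
    rw [Pi.sub_apply, ← hpt]
    linarith [h.momentum_const x t]
  rw [memLp_const_iff two_ne_zero ENNReal.ofNat_ne_top] at hconst
  exact sub_eq_zero.1 (by simpa using hconst)

theorem clm_eq_zero_of_speed_eq_zero (h : IsTravelingWave 0 κ w v p) (L : ℂ →L[ℝ] ℝ) {x₀ : ℝ}
    (hw₀ : L (w x₀) = 0) (hp₀ : L (p x₀) = 0) (x : ℝ) : L (w x) = 0 := by
  have hcont := h.isPrimitive.continuous
  have hf := (h.isPrimitive.clm_comp L).prodMk (h.isPrimitive_flux.clm_comp L)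
  have ha : LocallyIntegrable
      (fun t => |1 - ‖w t‖ ^ 2| + (2 + 2 * (2 * κ) ^ 2 * ⟪w t, v t⟫_ℝ ^ 2)) volume :=
    .add (Continuous.locallyIntegrable (by fun_prop)) <| .add (locallyIntegrable_const _) <|
      (locallyIntegrable_sq_inner hcont h.isPrimitive.locallyIntegrable h.memL2Loc).smul
        (2 * (2 * κ) ^ 2)
  refine congrArg Prod.fst (hf.eq_zero_of_norm_le ha ?_ (Prod.ext hw₀ hp₀) x)
  filter_upwards [h.ae_eq_flux] with t ht
  rw [ht, map_neg, Prod.norm_mk, norm_neg, ← Prod.norm_mk]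
  exact norm_map_prodMk_source_le κ L (w t) (v t)

theorem memNX (h : IsTravelingWave c κ w v p) (hw : MemX w) (hc : c ≠ 0) :
    MemNX w := by
  refine ⟨hw, iInf_pos_of_tendsto_cocompact h.isPrimitive.continuous.norm
    (hw.tendsto_norm h.isPrimitive) one_pos fun x => norm_pos_iff.2 fun hx => hc ?_⟩
  simpa [hx] using (h.momentum_eq hw x).symm

theorem exists_phase (h : IsTravelingWave 0 κ w v p) (hw : MemX w) :
    ∃ ϕ : ℝ, ∀ x, (Complex.exp (Complex.I * ϕ) * w x).im = 0 := by
  obtain ⟨x₀, hx₀⟩ := ((hw.tendsto_norm h.isPrimitive).eventually_ne one_ne_zero).exists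
  refine ⟨-(w x₀).arg, fun x => exp_neg_arg_mul_im_eq_zero (norm_ne_zero_iff.1 hx₀) ?_⟩
  exact h.clm_eq_zero_of_speed_eq_zero (innerSL ℝ (Complex.I * w x₀)) (x₀ := x₀)
    (by simp [Complex.inner, mul_comm]) (by simpa using h.momentum_eq hw x₀) x

end IsTravelingWave

end QGP

theorem proposition1p6_general (c κ : ℝ) (u : ℝ → ℂ) (hu : QGP.MemX u)
    (hsol : QGP.IsWeakSolution c κ u) :
    ∃ w : ℝ → ℂ, Continuous w ∧ w =ᵐ[volume] u ∧
      (c ≠ 0 → QGP.MemNX w) ∧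
      (c = 0 → ∃ ϕ : ℝ, ∀ x : ℝ, (Complex.exp (Complex.I * ϕ) * w x).im = 0) := by
  obtain ⟨w, v, p, hwu, hw⟩ := hsol.exists_isTravelingWave
  have hX : QGP.MemX w := hu.congr hwu.symm
  refine ⟨w, hw.isPrimitive.continuous, hwu, hw.memNX hX, ?_⟩
  rintro rfl
  exact hw.exists_phase hX

theorem proposition1p6 (c κ : ℝ) (hp : (c, κ) ∈ QGP.regionDtilde ∪ QGP.criticalC)
    (u : ℝ → ℂ) (hu : QGP.MemX u) (hsol : QGP.IsWeakSolution c κ u) :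
    ∃ w : ℝ → ℂ, Continuous w ∧ w =ᵐ[volume] u ∧
      (0 < c → QGP.MemNX w) ∧
      (c = 0 → ∃ ϕ : ℝ, ∀ x : ℝ, (Complex.exp (Complex.I * ϕ) * w x).im = 0) := by
  obtain ⟨w, hw, hwu, hNX, hphase⟩ := proposition1p6_general c κ u hu hsol
  exact ⟨w, hw, hwu, fun hc => hNX hc.ne', hphase⟩
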